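/- Let $a,b$ be positive real numbers and let $$\Phi_{a,b}(z)={}_1F_1(a;a+b;z)=\sum_{k=0}^{\infty}\frac{(a)_k}{(a+b)_k}\,\frac{z^k}{k!},\qquad z\in\mathbb{C},$$ where $(x)_k=x(x+1)\cdots(x+k-1)$. Let $z_{1;a,b},z_{2;a,b},\dots$ be the complex zeros of the entire function $\Phi_{a,b}$, repeated according to multiplicity, and let the hypergeometric zeta function be $$\zeta^{H}_{a,b}(s)=\sum_{k=1}^{\infty}\frac{1}{z_{k;a,b}^{\,s}},\qquad \operatorname{Re}s>1.$$ Then the series for $s=2$ converges absolutely, and $$\zeta^{H}_{a,b}(2)=-\frac{ab}{(a+b)^2(1+a+b)}.$$ -/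

import Mathlib

noncomputable section

/-- The Kummer function `M(a, b; z) = ∑ₖ (a)ₖ / (b)ₖ · zᵏ / k!`, where
`(a)ₖ = a (a + 1) ⋯ (a + k - 1)` is the rising factorial. -/
def kummerM (a b z : ℂ) : ℂ :=
  ∑' k : ℕ, (ascPochhammer ℂ k).eval a / (ascPochhammer ℂ k).eval b * (z ^ k / (k.factorial : ℂ))

/-- The function `Φ_{a,b}(z) = M(a, a + b; z)` for real parameters `a`, `b`. -/
def kummerPhi (a b : ℝ) (z : ℂ) : ℂ :=
  kummerM (a : ℂ) ((a : ℂ) + (b : ℂ)) z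

/-- The set of complex zeros of `Φ_{a,b}`. -/
def kummerZeros (a b : ℝ) : Set ℂ :=
  {z : ℂ | kummerPhi a b z = 0}

/-- The total contribution `m / z ^ s` of a zero `z` of `Φ_{a,b}` to the hypergeometric zeta
function, where `m` is the multiplicity of `z` (each zero is repeated according to its
multiplicity) and `z ^ s` is the principal power. -/
def hypergeometricZetaTerm (a b : ℝ) (s : ℂ) (z : kummerZeros a b) : ℂ :=
  (analyticOrderNatAt (kummerPhi a b) (z : ℂ) : ℂ) * (1 / (z : ℂ) ^ s)

/-- The hypergeometric zeta function: the sum of `1 / z ^ s` over all complex zeros `z` of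
`Φ_{a,b}`, repeated according to multiplicity (as an unconditionally convergent series). -/
def hypergeometricZeta (a b : ℝ) (s : ℂ) : ℂ :=
  ∑' z : kummerZeros a b, hypergeometricZetaTerm a b s z

end

open Complex Metric Filter Topology

/-! `Φ = kummerPhi a b` has Taylor coefficients `c k / k!` with `‖c k‖ ≤ 1`, so it is entire, `Φ 0 =
1` and `‖Φ z‖ ≤ exp ‖z‖`. For every entire `f` with `f 0 = 1` and exponential type, the sum of `m_ρ
/ ρ ^ 2` is `-(f'/f)'(0) = f'(0) ^ 2 - f''(0)` (`tsum_zeros_of_exponential_type`); for `Φ` this is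
`c 1 ^ 2 - c 2`.

No Hadamard product is needed. Divide `f` by the polynomial `P` of its zeros in `‖z‖ ≤ n`, so that
`f = P * g`. The factor `P` contributes the partial sum to `-(f'/f)'(0)`. The quotient `g` has no
zeros in the disc and is at most `exp (2 * C * n)` there by the maximum principle, so
Borel–Carathéodory and Cauchy give `(g'/g)'(0) = O(1/n)`. Absolute convergence comes from counting
`O(R)` zeros in a disc of radius `R` and summing over dyadic shells. -/

/-! ### Dividing out finitely many zeros -/

/-- An entire function with a zero of order `n` at `ρ ≠ 0` is `(1 - z / ρ) ^ n` times an entire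
function that does not vanish at `ρ`. -/
theorem Differentiable.exists_eq_pow_mul_of_analyticOrderAt {ρ : ℂ} (hρ : ρ ≠ 0) (n : ℕ) {f : ℂ → ℂ}
    (hf : Differentiable ℂ f) (hn : analyticOrderAt f ρ = n) :
    ∃ g : ℂ → ℂ, Differentiable ℂ g ∧ g ρ ≠ 0 ∧ ∀ z, f z = (1 - z / ρ) ^ n * g z := by
  induction n generalizing f with
  | zero =>
    refine ⟨f, hf, ?_, by simp⟩
    simpa [analyticOrderAt_eq_zero, hf.analyticAt ρ] using hn
  | succ n ih =>
    have h0 : f ρ = 0 := by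
      by_contra h
      rw [analyticOrderAt_eq_zero.2 (Or.inr h)] at hn
      exact absurd hn.symm (by simp)
    have hfac : ∀ z, f z = (1 - z / ρ) * (-ρ * dslope f ρ z) := by
      intro z
      have h := sub_smul_dslope f ρ z
      rw [h0, sub_zero, smul_eq_mul] at h
      rw [← h]
      field_simp
      ring
    have hd : Differentiable ℂ (fun z => -ρ * dslope f ρ z) := by
      refine Differentiable.const_mul ?_ _
      rw [← differentiableOn_univ, differentiableOn_dslope univ_mem]
      exact hf.differentiableOn
    have hlin : analyticOrderAt (fun z : ℂ => 1 - z / ρ) ρ = (1 : ℕ) := by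
      rw [AnalyticAt.analyticOrderAt_eq_natCast
        (by exact (by fun_prop : Differentiable ℂ (fun z : ℂ => 1 - z / ρ)).analyticAt ρ)]
      refine ⟨fun _ => -ρ⁻¹, by fun_prop, by simpa using hρ, .of_forall fun z => ?_⟩
      simp only [pow_one, smul_eq_mul]
      field_simp
      ring
    -- Orders add under products, and the finite order `1` of the linear factor cancels in `ℕ∞`.
    have hord : analyticOrderAt (fun z => -ρ * dslope f ρ z) ρ = n := by
      have h : f = (fun z : ℂ => 1 - z / ρ) * (fun z => -ρ * dslope f ρ z) := funext hfac
      rw [h, analyticOrderAt_mul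
        (by exact (by fun_prop : Differentiable ℂ (fun z : ℂ => 1 - z / ρ)).analyticAt ρ)
        (hd.analyticAt ρ), hlin, add_comm] at hn
      push_cast at hn
      exact (ENat.add_left_injective_of_ne_top (by simp : (1 : ℕ∞) ≠ ⊤)) hn
    obtain ⟨g, hg, hgρ, h⟩ := ih hd hord
    refine ⟨g, hg, hgρ, fun z => ?_⟩
    rw [hfac z, h z, pow_succ']
    ring

/-- The polynomial `∏ (1 - z / ρ) ^ m_ρ` over the points `ρ` of a finite set, where `m_ρ` is the
order of vanishing of `f` at `ρ`. -/
noncomputable def zeroProd (f : ℂ → ℂ) (S : Finset ℂ) (z : ℂ) : ℂ :=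
  ∏ ρ ∈ S, (1 - z / ρ) ^ analyticOrderNatAt f ρ

theorem differentiable_zeroProd (f : ℂ → ℂ) (S : Finset ℂ) : Differentiable ℂ (zeroProd f S) := by
  unfold zeroProd
  fun_prop

@[simp] theorem zeroProd_zero (f : ℂ → ℂ) (S : Finset ℂ) : zeroProd f S 0 = 1 := by
  simp [zeroProd]

theorem Differentiable.exists_eq_zeroProd_mul {f : ℂ → ℂ} (hf : Differentiable ℂ f)
    (hord : ∀ z, analyticOrderAt f z ≠ ⊤) (S : Finset ℂ) (hS : ∀ ρ ∈ S, ρ ≠ 0) :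
    ∃ g : ℂ → ℂ, Differentiable ℂ g ∧ (∀ ρ ∈ S, g ρ ≠ 0) ∧ ∀ z, f z = zeroProd f S z * g z := by
  classical
  induction S using Finset.induction_on with
  | empty => exact ⟨f, hf, by simp, by simp [zeroProd]⟩
  | insert ρ S hρS ih =>
    obtain ⟨g, hg, hgS, hfg⟩ := ih fun x hx => hS x (Finset.mem_insert_of_mem hx)
    have hρ : ρ ≠ 0 := hS ρ (Finset.mem_insert_self _ _)
    have hP : zeroProd f S ρ ≠ 0 := by
      refine Finset.prod_ne_zero_iff.2 fun x hx => pow_ne_zero _ ?_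
      have hx0 : x ≠ 0 := hS x (Finset.mem_insert_of_mem hx)
      intro h
      have : ρ = x := by
        field_simp at h
        linear_combination -h
      exact hρS (this ▸ hx)
    have ho : analyticOrderAt g ρ = (analyticOrderNatAt f ρ : ℕ) := by
      rw [Nat.cast_analyticOrderNatAt (hord ρ)]
      conv_rhs => rw [show f = zeroProd f S * g from funext hfg]
      rw [analyticOrderAt_mul ((differentiable_zeroProd f S).analyticAt ρ) (hg.analyticAt ρ),
        analyticOrderAt_eq_zero.2 (Or.inr hP), zero_add]
    obtain ⟨h, hh, hhρ, hgh⟩ := hg.exists_eq_pow_mul_of_analyticOrderAt hρ _ ho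
    refine ⟨h, hh, fun x hx => ?_, fun z => ?_⟩
    · rcases Finset.mem_insert.1 hx with rfl | hx
      · exact hhρ
      · intro h0
        exact hgS x hx (by rw [hgh, h0, mul_zero])
    · rw [hfg z, hgh z, zeroProd, zeroProd, Finset.prod_insert hρS]
      ring

/-! ### Growth and zero counting -/

/-- Maximum principle on a disc centered at the origin. -/
theorem Differentiable.norm_le_of_forall_sphere {g : ℂ → ℂ} (hg : Differentiable ℂ g) {R M : ℝ}
    (hR : 0 < R) (h : ∀ z, ‖z‖ = R → ‖g z‖ ≤ M) {z : ℂ} (hz : ‖z‖ ≤ R) : ‖g z‖ ≤ M := by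
  refine norm_le_of_forall_mem_frontier_norm_le (isBounded_ball (x := (0 : ℂ)) (r := R))
    hg.diffContOnCl (fun w hw => ?_) ?_
  · rw [frontier_ball _ hR.ne'] at hw
    exact h w (by simpa using hw)
  · rw [closure_ball _ hR.ne']
    simpa using hz

/-- If all points of `S` have norm at most `R`, then the polynomial `zeroProd f S` is at least
`k ^ N` in norm on the circle of radius `(k + 1) * R`, where `N` counts multiplicities. -/
theorem pow_le_norm_zeroProd (f : ℂ → ℂ) {S : Finset ℂ} {R k : ℝ} (hk : 0 ≤ k)
    (hS : ∀ ρ ∈ S, ρ ≠ 0 ∧ ‖ρ‖ ≤ R) {z : ℂ} (hz : ‖z‖ = (k + 1) * R) :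
    k ^ (∑ ρ ∈ S, analyticOrderNatAt f ρ) ≤ ‖zeroProd f S z‖ := by
  rw [zeroProd, norm_prod, ← Finset.prod_pow_eq_pow_sum]
  refine Finset.prod_le_prod (fun _ _ => by positivity) fun ρ hρ => ?_
  rw [norm_pow]
  refine pow_le_pow_left₀ hk ?_ _
  obtain ⟨h0, hR⟩ := hS ρ hρ
  have hp : 0 < ‖ρ‖ := norm_pos_iff.2 h0
  have h1 : k + 1 ≤ ‖z / ρ‖ := by
    rw [norm_div, le_div_iff₀ hp, hz]
    gcongr
  have h2 := norm_sub_norm_le (z / ρ) 1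
  rw [norm_one, norm_sub_rev] at h2
  linarith

/-- A quotient of an entire function of exponential type by the polynomial of its small zeros. -/
theorem norm_quotient_mul_pow_le {f g : ℂ → ℂ} {C R k : ℝ} (hk : 0 ≤ k) (hR : 0 < R)
    (hfC : ∀ z, ‖f z‖ ≤ Real.exp (C * ‖z‖)) {S : Finset ℂ}
    (hS : ∀ ρ ∈ S, ρ ≠ 0 ∧ ‖ρ‖ ≤ R) (hg : Differentiable ℂ g)
    (hfg : ∀ z, f z = zeroProd f S z * g z) {z : ℂ} (hz : ‖z‖ ≤ (k + 1) * R) :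
    ‖g z‖ * k ^ (∑ ρ ∈ S, analyticOrderNatAt f ρ) ≤ Real.exp (C * ((k + 1) * R)) := by
  set N := ∑ ρ ∈ S, analyticOrderNatAt f ρ
  have hd : Differentiable ℂ (fun z => g z * (k : ℂ) ^ N) := hg.mul_const _
  have := hd.norm_le_of_forall_sphere (M := Real.exp (C * ((k + 1) * R))) (by positivity)
    (fun w hw => ?_) hz
  · simpa [abs_of_nonneg hk] using this
  · have h1 := hfC w
    rw [hfg w, hw, norm_mul] at h1
    have h2 := pow_le_norm_zeroProd f hk hS hw
    refine le_trans ?_ h1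
    simp only [norm_mul, norm_pow, norm_real, Real.norm_eq_abs, abs_of_nonneg hk]
    rw [mul_comm]
    gcongr

theorem analyticOrderAt_ne_top_of_apply_ne_zero {f : ℂ → ℂ} (hf : Differentiable ℂ f)
    {w : ℂ} (hw : f w ≠ 0) (z : ℂ) : analyticOrderAt f z ≠ ⊤ := by
  intro h
  rw [AnalyticOnNhd.analyticOrderAt_eq_top_iff_eq_zero z fun w => hf.analyticAt w] at h
  exact hw (by simp [h])

/-- An entire function of exponential type has `O(R)` zeros in the disc of radius `R`. -/
theorem sum_analyticOrderNatAt_le {f : ℂ → ℂ} (hf : Differentiable ℂ f) (hf0 : f 0 = 1) {C : ℝ}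
    (hfC : ∀ z, ‖f z‖ ≤ Real.exp (C * ‖z‖)) {R : ℝ} (hR : 0 < R) {S : Finset ℂ}
    (hS : ∀ ρ ∈ S, ρ ≠ 0 ∧ ‖ρ‖ ≤ R) :
    ((∑ ρ ∈ S, analyticOrderNatAt f ρ : ℕ) : ℝ) ≤ 3 * C / Real.log 2 * R := by
  obtain ⟨g, hg, -, hfg⟩ := hf.exists_eq_zeroProd_mul
    (analyticOrderAt_ne_top_of_apply_ne_zero hf (w := 0) (by simp [hf0])) S fun ρ hρ => (hS ρ hρ).1
  have hg0 : g 0 = 1 := by simpa [hf0] using (hfg 0).symm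
  -- With `k = 2`, the circle of radius `3 * R` gives `2 ^ N ≤ exp (3 * C * R)` at the center; take
  -- logarithms.
  have h := norm_quotient_mul_pow_le zero_le_two hR hfC hS hg hfg (z := 0)
    (by rw [norm_zero]; positivity)
  rw [hg0, norm_one, one_mul, ← Real.log_le_log_iff (by positivity) (Real.exp_pos _), Real.log_exp,
    Real.log_pow] at h
  have hl : 0 < Real.log 2 := Real.log_pos one_lt_two
  rw [div_mul_eq_mul_div, le_div_iff₀ hl]
  linarith

/-! ### Second logarithmic derivatives -/

/-- Bound for the second logarithmic derivative at the center of a disc in which the function does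
not vanish. -/
theorem norm_deriv_logDeriv_le {g : ℂ → ℂ} (hg : Differentiable ℂ g) (hg0 : g 0 = 1) {R M : ℝ}
    (hR : 0 < R) (hM : 0 < M) (hne : ∀ z ∈ ball (0 : ℂ) R, g z ≠ 0)
    (hle : ∀ z ∈ ball (0 : ℂ) R, ‖g z‖ ≤ Real.exp M) :
    ‖deriv (logDeriv g) 0‖ ≤ 16 * M / R ^ 2 := by
  have hlog : DifferentiableOn ℂ (logDeriv g) (ball 0 R) :=
    (hg.differentiableOn.deriv isOpen_ball).div hg.differentiableOn hne
  -- A primitive `h` of `g'/g` with `h 0 = 0` is a branch of `log g`, since `g * exp (-h)` has zero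
  -- derivative.
  obtain ⟨h, hh0, hh⟩ := hlog.isExactOn_ball.with_val_at 0 0
  have h0mem : (0 : ℂ) ∈ ball (0 : ℂ) R := mem_ball_self hR
  have hhd : DifferentiableOn ℂ h (ball 0 R) := fun z hz =>
    (hh z hz).differentiableAt.differentiableWithinAt
  have hexp : ∀ z ∈ ball (0 : ℂ) R, g z = exp (h z) := by
    have key : ∀ z ∈ ball (0 : ℂ) R, HasDerivAt (fun z => g z * exp (-h z)) 0 z := by
      intro z hz
      convert! (hg z).hasDerivAt.mul (hh z hz).neg.cexp using 1
      have := hne z hz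
      rw [logDeriv_apply]
      field_simp
      ring
    intro z hz
    have hc := (convex_ball (0 : ℂ) R).is_const_of_fderivWithin_eq_zero (𝕜 := ℂ)
      (f := fun z => g z * exp (-h z))
      (fun z hz => (key z hz).differentiableAt.differentiableWithinAt)
      (fun z hz => by
        rw [fderivWithin_of_isOpen isOpen_ball hz]
        ext
        simp [(key z hz).deriv]) hz h0mem
    simp only [hg0, hh0, neg_zero, exp_zero, mul_one] at hc
    rw [exp_neg] at hc
    field_simp at hc
    exact hc
  have hre : Set.MapsTo h (ball 0 R) {z | z.re ≤ M} := fun z hz => by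
    have := hle z hz
    rw [hexp z hz, norm_exp, Real.exp_le_exp] at this
    exact this
  have hsub : closedBall (0 : ℂ) (R / 2) ⊆ ball 0 R := closedBall_subset_ball (by linarith)
  have hbound : ∀ z ∈ sphere (0 : ℂ) (R / 2), ‖h z‖ ≤ 2 * M := by
    intro z hz
    have h1 := borelCaratheodory_zero hM hhd hre hR (hsub (sphere_subset_closedBall hz)) hh0
    have hz' : ‖z‖ = R / 2 := by simpa using hz
    rw [hz'] at h1
    refine h1.trans (le_of_eq ?_)
    field_simp
    ring
  have hcl : DiffContOnCl ℂ h (ball 0 (R / 2)) :=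
    (hhd.mono hsub).diffContOnCl_ball le_rfl
  -- Cauchy's estimate on radius `R / 2` gives `2! * (2 * M) / (R / 2) ^ 2 = 16 * M / R ^ 2`.
  have hcau := norm_iteratedDeriv_le_of_forall_mem_sphere_norm_le 2 (half_pos hR) hcl hbound
  have heq : iteratedDeriv 2 h 0 = deriv (logDeriv g) 0 := by
    rw [iteratedDeriv_succ, iteratedDeriv_one]
    refine Filter.EventuallyEq.deriv_eq ?_
    filter_upwards [isOpen_ball.mem_nhds h0mem] with z hz using (hh z hz).deriv
  rw [heq] at hcau
  refine hcau.trans (le_of_eq ?_)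
  simp only [Nat.factorial]
  push_cast
  field_simp
  norm_num

theorem deriv_logDeriv_eq {f : ℂ → ℂ} (hf : Differentiable ℂ f) {z : ℂ} (hz : f z ≠ 0) :
    deriv (logDeriv f) z = (deriv (deriv f) z * f z - deriv f z ^ 2) / f z ^ 2 := by
  rw [logDeriv, deriv_div (hf.deriv z) (hf z) hz, sq (deriv f z)]

theorem deriv_logDeriv_mul {P g : ℂ → ℂ} (hP : Differentiable ℂ P) (hg : Differentiable ℂ g)
    {z : ℂ} (hPz : P z ≠ 0) (hgz : g z ≠ 0) :
    deriv (logDeriv fun w => P w * g w) z = deriv (logDeriv P) z + deriv (logDeriv g) z := by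
  have h : logDeriv (fun w => P w * g w) =ᶠ[𝓝 z] fun w => logDeriv P w + logDeriv g w := by
    filter_upwards [hP.continuous.continuousAt.eventually_ne hPz,
      hg.continuous.continuousAt.eventually_ne hgz] with w h1 h2
    exact logDeriv_mul w h1 h2 (hP w) (hg w)
  rw [h.deriv_eq]
  exact deriv_add ((hP.deriv z).div (hP z) hPz) ((hg.deriv z).div (hg z) hgz)

theorem deriv_logDeriv_zeroProd (f : ℂ → ℂ) {S : Finset ℂ} (hS : ∀ ρ ∈ S, ρ ≠ 0) :
    deriv (logDeriv (zeroProd f S)) 0 = -∑ ρ ∈ S, (analyticOrderNatAt f ρ : ℂ) * (1 / ρ ^ 2) := by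
  have hev : logDeriv (zeroProd f S) =ᶠ[𝓝 0]
      fun z => ∑ ρ ∈ S, (analyticOrderNatAt f ρ : ℂ) * (-ρ⁻¹ / (1 - z / ρ)) := by
    have hne : ∀ᶠ z : ℂ in 𝓝 0, ∀ ρ ∈ S, 1 - z / ρ ≠ 0 := by
      rw [Filter.eventually_all_finset]
      intro ρ _
      exact (by fun_prop : Continuous fun z : ℂ => 1 - z / ρ).continuousAt.eventually_ne (by simp)
    filter_upwards [hne] with z hz
    refine (logDeriv_prod (f := fun ρ z => (1 - z / ρ) ^ analyticOrderNatAt f ρ)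
      (fun ρ hρ => pow_ne_zero _ (hz ρ hρ)) (fun ρ _ => by fun_prop)).trans ?_
    refine Finset.sum_congr rfl fun ρ _ => ?_
    rw [logDeriv_fun_pow (by fun_prop), logDeriv_apply]
    congr 2
    simp [deriv_div_const]
  have hterm : ∀ ρ ∈ S, HasDerivAt
      (fun z : ℂ => (analyticOrderNatAt f ρ : ℂ) * (-ρ⁻¹ / (1 - z / ρ)))
      (-((analyticOrderNatAt f ρ : ℂ) * (1 / ρ ^ 2))) 0 := by
    intro ρ hρ
    have h1 : HasDerivAt (fun z : ℂ => 1 - z / ρ) (-(1 / ρ)) 0 :=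
      ((hasDerivAt_id (0 : ℂ)).div_const ρ).const_sub 1
    have h2 := ((hasDerivAt_const (0 : ℂ) (-ρ⁻¹)).div h1 (by simp)).const_mul
      (analyticOrderNatAt f ρ : ℂ)
    convert! h2 using 1
    have := hS ρ hρ
    simp
    left
    field_simp
  rw [hev.deriv_eq, (HasDerivAt.fun_sum hterm).deriv, Finset.sum_neg_distrib]

/-! ### Summation over the zeros -/

/-- A weight on the plane whose mass in the disc of radius `R` is `O(R)` and which vanishes near
the origin has bounded sums against `‖ρ‖ ^ (-2)`. -/
theorem sum_mul_inv_norm_sq_le {m : ℂ → ℕ} {A r : ℝ} (hA : 0 ≤ A) (hr : 0 < r) {S : Finset ℂ}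
    (hSr : ∀ ρ ∈ S, r ≤ ‖ρ‖)
    (hS : ∀ T ⊆ S, ∀ R : ℝ, 0 < R → (∀ ρ ∈ T, ‖ρ‖ ≤ R) → ((∑ ρ ∈ T, m ρ : ℕ) : ℝ) ≤ A * R) :
    ∑ ρ ∈ S, (m ρ : ℝ) * (1 / ‖ρ‖ ^ 2) ≤ 4 * A / r := by
  classical
  have hex : ∀ ρ : ℂ, ∃ k : ℕ, ρ ∈ S → r * 2 ^ k ≤ ‖ρ‖ ∧ ‖ρ‖ ≤ r * 2 ^ (k + 1) := by
    intro ρ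
    by_cases hρ : ρ ∈ S
    · obtain ⟨k, h1, h2⟩ := exists_nat_pow_near (x := ‖ρ‖ / r) (y := 2)
        ((one_le_div hr).2 (hSr ρ hρ)) one_lt_two
      rw [le_div_iff₀ hr] at h1
      rw [div_lt_iff₀ hr] at h2
      exact ⟨k, fun _ => ⟨by linarith, by linarith⟩⟩
    · exact ⟨0, fun h => absurd h hρ⟩
  choose k hk using hex
  rw [← Finset.sum_fiberwise_of_maps_to (t := S.image k) fun x hx => Finset.mem_image_of_mem k hx]
  calc ∑ j ∈ S.image k, ∑ ρ ∈ S with k ρ = j, (m ρ : ℝ) * (1 / ‖ρ‖ ^ 2)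
      -- Shell `j` has mass at most `A * r * 2 ^ (j + 1)` and each point weighs at most `(r * 2 ^ j)
      -- ^ (-2)`.
      ≤ ∑ j ∈ S.image k, 2 * A / r * (1 / 2) ^ j := by
        refine Finset.sum_le_sum fun j _ => ?_
        have h1 : ∑ ρ ∈ S with k ρ = j, (m ρ : ℝ) * (1 / ‖ρ‖ ^ 2) ≤
            ∑ ρ ∈ S with k ρ = j, (m ρ : ℝ) * (1 / (r * 2 ^ j) ^ 2) := by
          refine Finset.sum_le_sum fun ρ hρ => ?_
          obtain ⟨hρS, rfl⟩ := Finset.mem_filter.1 hρ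
          have := (hk ρ hρS).1
          gcongr
        have h2 := hS {ρ ∈ S | k ρ = j} (Finset.filter_subset _ _) (r * 2 ^ (j + 1)) (by positivity)
          fun ρ hρ => by
            obtain ⟨hρS, rfl⟩ := Finset.mem_filter.1 hρ
            exact (hk ρ hρS).2
        rw [← Finset.sum_mul] at h1
        push_cast at h2
        calc _ ≤ _ := h1
          _ ≤ A * (r * 2 ^ (j + 1)) * (1 / (r * 2 ^ j) ^ 2) := by gcongr
          _ = 2 * A / r * (1 / 2) ^ j := by
            rw [div_pow, one_pow, pow_succ]
            field_simp
    _ = 2 * A / r * ∑ j ∈ S.image k, (1 / 2 : ℝ) ^ j := by rw [Finset.mul_sum]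
    _ ≤ 2 * A / r * 2 := by
        gcongr
        exact (summable_geometric_two.sum_le_tsum _ fun _ _ => by positivity).trans
          tsum_geometric_two.le
    _ = 4 * A / r := by ring

theorem Differentiable.finite_zeros_inter_closedBall {f : ℂ → ℂ} (hf : Differentiable ℂ f)
    {w : ℂ} (hw : f w ≠ 0) (R : ℝ) : {z : {z : ℂ | f z = 0} | ‖(z : ℂ)‖ ≤ R}.Finite := by
  have h1 := AnalyticOnNhd.preimage_zero_mem_codiscrete (fun z _ => hf.analyticAt z) hw
  have h2 := (isCompact_closedBall (0 : ℂ) R).finite_sdiff_of_mem_codiscreteWithin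
    (codiscreteWithin_mono (Set.subset_univ _) h1)
  refine (h2.preimage (f := Subtype.val) Subtype.val_injective.injOn).subset fun z hz => ?_
  refine ⟨mem_closedBall_zero_iff.2 hz, fun h => h z.2⟩

/-- Since `f 0 = 1`, the zeros stay away from the origin, so the linear zero count controls all
finite partial sums. -/
theorem summable_norm_zeros_of_exponential_type {f : ℂ → ℂ} (hf : Differentiable ℂ f)
    (hf0 : f 0 = 1) {C : ℝ} (hC : 0 ≤ C) (hfC : ∀ z, ‖f z‖ ≤ Real.exp (C * ‖z‖)) :
    Summable fun z : {z : ℂ | f z = 0} => ‖(analyticOrderNatAt f z : ℂ) * (1 / (z : ℂ) ^ 2)‖ := by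
  have hne : ∀ᶠ z in 𝓝 (0 : ℂ), f z ≠ 0 := hf.continuous.continuousAt.eventually_ne (by simp [hf0])
  obtain ⟨r, hr, hball⟩ := eventually_nhds_iff_ball.1 hne
  have hzr : ∀ z, f z = 0 → r ≤ ‖z‖ := fun z hz => by
    by_contra! h
    exact hball z (by simpa using h) hz
  have hl : 0 < Real.log 2 := Real.log_pos one_lt_two
  refine summable_of_sum_le (c := 4 * (3 * C / Real.log 2) / r) (fun _ => norm_nonneg _) fun u => ?_
  have hu : ∀ ρ ∈ u.map (Function.Embedding.subtype _), f ρ = 0 := by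
    intro ρ hρ
    obtain ⟨z, -, rfl⟩ := Finset.mem_map.1 hρ
    exact z.2
  have h := sum_mul_inv_norm_sq_le (m := analyticOrderNatAt f) (A := 3 * C / Real.log 2)
    (by positivity) hr (S := u.map (Function.Embedding.subtype _)) (fun ρ hρ => hzr ρ (hu ρ hρ))
    fun T hT R hR hTR => sum_analyticOrderNatAt_le hf hf0 hfC hR fun ρ hρ =>
      ⟨norm_pos_iff.1 (hr.trans_le (hzr ρ (hu ρ (hT hρ)))), hTR ρ hρ⟩
  rw [Finset.sum_map] at h
  simp only [norm_mul, norm_div, norm_pow, norm_natCast, norm_one]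
  exact h

theorem tsum_zeros_of_exponential_type {f : ℂ → ℂ} (hf : Differentiable ℂ f)
    (hf0 : f 0 = 1) {C : ℝ} (hC : 0 < C) (hfC : ∀ z, ‖f z‖ ≤ Real.exp (C * ‖z‖)) :
    ∑' z : {z : ℂ | f z = 0}, (analyticOrderNatAt f z : ℂ) * (1 / (z : ℂ) ^ 2) =
      deriv f 0 ^ 2 - deriv (deriv f) 0 := by
  have hf0' : f 0 ≠ 0 := by simp [hf0]
  have hsum := (summable_norm_zeros_of_exponential_type hf hf0 hC.le hfC).of_norm.hasSum
  have hfin := fun n : ℕ => hf.finite_zeros_inter_closedBall hf0' n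
  have hT : Tendsto (fun n : ℕ => (hfin n).toFinset) atTop atTop := by
    refine tendsto_atTop_finset_of_monotone (fun a b hab z hz => ?_) fun z => ?_
    · simp only [Set.Finite.mem_toFinset, Set.mem_ofPred_eq] at hz ⊢
      exact hz.trans (by exact_mod_cast hab)
    · obtain ⟨n, hn⟩ := exists_nat_ge ‖(z : ℂ)‖
      exact ⟨n, by simpa using hn⟩
  refine tendsto_nhds_unique (hsum.comp hT) ?_
  rw [tendsto_iff_norm_sub_tendsto_zero]
  refine squeeze_zero' (.of_forall fun _ => norm_nonneg _) ?_
    (tendsto_const_div_atTop_nhds_zero_nat (32 * C))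
  filter_upwards [eventually_gt_atTop 0] with n hn
  have hn' : (0 : ℝ) < n := by exact_mod_cast hn
  set S : Finset ℂ := (hfin n).toFinset.map (Function.Embedding.subtype _) with hSdef
  have hSmem : ∀ ρ, ρ ∈ S ↔ f ρ = 0 ∧ ‖ρ‖ ≤ n := by
    intro ρ
    rw [hSdef, Finset.mem_map]
    refine ⟨?_, fun h => ⟨⟨ρ, h.1⟩, (hfin n).mem_toFinset.2 h.2, rfl⟩⟩
    rintro ⟨z, hz, rfl⟩
    exact ⟨z.2, (hfin n).mem_toFinset.1 hz⟩
  have hS : ∀ ρ ∈ S, ρ ≠ 0 ∧ ‖ρ‖ ≤ n := fun ρ hρ =>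
    ⟨fun h => hf0' (h ▸ ((hSmem ρ).1 hρ).1), ((hSmem ρ).1 hρ).2⟩
  obtain ⟨g, hg, hgS, hfg⟩ := hf.exists_eq_zeroProd_mul
    (analyticOrderAt_ne_top_of_apply_ne_zero hf hf0') S fun ρ hρ => (hS ρ hρ).1
  have hg0 : g 0 = 1 := by simpa [hf0] using (hfg 0).symm
  -- The case `k = 1`: `‖P‖ ≥ 1` on the circle of radius `2 * n`, hence `M = 2 * C * n` and the
  -- error `16 * M / n ^ 2 = 32 * C / n`. A zero of `g` in the disc would be a zero of `f` in `S`,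
  -- where `g` does not vanish.
  have hD := norm_deriv_logDeriv_le hg hg0 hn' (M := C * (2 * n)) (by positivity)
    (fun z hz h0 => hgS z ((hSmem z).2 ⟨by rw [hfg, h0, mul_zero],
      (mem_ball_zero_iff.1 hz).le⟩) h0)
    (fun z hz => by
      have h := norm_quotient_mul_pow_le zero_le_one hn' hfC hS hg hfg (z := z)
        (by linarith [mem_ball_zero_iff.1 hz])
      rw [one_pow, mul_one, one_add_one_eq_two] at h
      exact h)
  have hadd := deriv_logDeriv_mul (differentiable_zeroProd f S) hg (z := 0) (by simp) (by simp [hg0])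
  rw [← funext hfg, deriv_logDeriv_zeroProd f (fun ρ hρ => (hS ρ hρ).1),
    deriv_logDeriv_eq hf hf0', hf0] at hadd
  have hsumS : ∑ z ∈ (hfin n).toFinset, (analyticOrderNatAt f z : ℂ) * (1 / (z : ℂ) ^ 2) =
      ∑ ρ ∈ S, (analyticOrderNatAt f ρ : ℂ) * (1 / ρ ^ 2) := by
    rw [hSdef, Finset.sum_map]
    rfl
  have hfinal : (∑ ρ ∈ S, (analyticOrderNatAt f ρ : ℂ) * (1 / ρ ^ 2)) -
      (deriv f 0 ^ 2 - deriv (deriv f) 0) = deriv (logDeriv g) 0 := by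
    linear_combination hadd
  simp only [Function.comp_apply]
  rw [hsumS, hfinal]
  refine hD.trans (le_of_eq ?_)
  field_simp
  norm_num

/-! ### The Kummer function -/

/-- The exponential generating function of a bounded sequence can be differentiated termwise. -/
theorem hasDerivAt_tsum_pow_div_factorial {c : ℕ → ℂ} (hc : ∀ k, ‖c k‖ ≤ 1) (z : ℂ) :
    HasDerivAt (fun z => ∑' k : ℕ, c k * (z ^ k / (k.factorial : ℂ)))
      (∑' k : ℕ, c (k + 1) * (z ^ k / (k.factorial : ℂ))) z := by
  set F : ℕ → ℂ → ℂ := fun k z => c k * (z ^ k / (k.factorial : ℂ)) with hF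
  have hu : Summable fun k : ℕ => (‖z‖ + 1) ^ k / (k.factorial : ℝ) :=
    Real.summable_pow_div_factorial _
  have hFd : ∀ k, DifferentiableOn ℂ (F k) (ball 0 (‖z‖ + 1)) := fun k => by
    simp only [hF]
    fun_prop
  have hle : ∀ k, ∀ w ∈ ball (0 : ℂ) (‖z‖ + 1), ‖F k w‖ ≤ (‖z‖ + 1) ^ k / (k.factorial : ℝ) := by
    intro k w hw
    have hw' := (mem_ball_zero_iff.1 hw).le
    simp only [hF, norm_mul, norm_div, norm_pow, norm_natCast]
    refine (mul_le_of_le_one_left (by positivity) (hc k)).trans ?_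
    gcongr
  have hz : z ∈ ball (0 : ℂ) (‖z‖ + 1) := by simp
  have hd := (differentiableOn_tsum_of_summable_norm hu hFd isOpen_ball hle).differentiableAt
    (isOpen_ball.mem_nhds hz)
  have hs := hasSum_deriv_of_summable_norm hu hFd isOpen_ball hle hz
  have hderiv : ∀ k, deriv (F (k + 1)) z = c (k + 1) * (z ^ k / (k.factorial : ℂ)) := by
    intro k
    simp only [hF, deriv_const_mul_field, deriv_div_const, deriv_pow_field, Nat.factorial_succ]
    have h1 : (k.factorial : ℂ) ≠ 0 := by exact_mod_cast k.factorial_ne_zero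
    have h2 : (k : ℂ) + 1 ≠ 0 := by exact_mod_cast k.succ_ne_zero
    push_cast
    field_simp
  have h0 : deriv (F 0) z = 0 := by simp [hF]
  have ht := hs.tsum_eq
  -- The constant term has derivative zero, which shifts the coefficients by one.
  rw [hs.summable.tsum_eq_zero_add, h0, zero_add] at ht
  simp only [hderiv] at ht
  rw [ht]
  exact hd.hasDerivAt

theorem norm_tsum_pow_div_factorial_le {c : ℕ → ℂ} (hc : ∀ k, ‖c k‖ ≤ 1) (z : ℂ) :
    ‖∑' k : ℕ, c k * (z ^ k / (k.factorial : ℂ))‖ ≤ Real.exp ‖z‖ := by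
  rw [Real.exp_eq_exp_ℝ, NormedSpace.exp_eq_tsum_div]
  refine tsum_of_norm_bounded (Real.summable_pow_div_factorial ‖z‖).hasSum fun k => ?_
  simp only [norm_mul, norm_div, norm_pow, norm_natCast]
  exact mul_le_of_le_one_left (by positivity) (hc k)

theorem tsum_pow_div_factorial_zero (c : ℕ → ℂ) :
    ∑' k : ℕ, c k * ((0 : ℂ) ^ k / (k.factorial : ℂ)) = c 0 := by
  rw [tsum_eq_single 0 fun k hk => by simp [hk]]
  simp

/-- The quotient is a product of factors `(a + j) / (a + b + j) ≤ 1`. -/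
theorem norm_ascPochhammer_div_le {a b : ℝ} (ha : 0 < a) (hb : 0 < b) (k : ℕ) :
    ‖(ascPochhammer ℂ k).eval (a : ℂ) / (ascPochhammer ℂ k).eval ((a : ℂ) + (b : ℂ))‖ ≤ 1 := by
  induction k with
  | zero => simp
  | succ k ih =>
    rw [ascPochhammer_succ_eval, ascPochhammer_succ_eval, mul_div_mul_comm, norm_mul]
    refine mul_le_one₀ ih (norm_nonneg _) ?_
    rw [show ((a : ℂ) + k) / ((a : ℂ) + b + k) = (((a + k) / (a + b + k) : ℝ) : ℂ) by push_cast; rfl,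
      norm_real, Real.norm_of_nonneg (by positivity), div_le_one (by positivity)]
    linarith

theorem mainTheorem6 (a b : ℝ) (ha : 0 < a) (hb : 0 < b) :
    Summable (fun z : kummerZeros a b => ‖hypergeometricZetaTerm a b 2 z‖) ∧
      hypergeometricZeta a b 2 =
        -(((a : ℂ) * (b : ℂ)) / (((a : ℂ) + (b : ℂ)) ^ 2 * (1 + (a : ℂ) + (b : ℂ)))) := by
  set c : ℕ → ℂ := fun k =>
    (ascPochhammer ℂ k).eval (a : ℂ) / (ascPochhammer ℂ k).eval ((a : ℂ) + (b : ℂ)) with hcdef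
  have hc : ∀ k, ‖c k‖ ≤ 1 := norm_ascPochhammer_div_le ha hb
  have hd1 := hasDerivAt_tsum_pow_div_factorial hc
  have hd2 := hasDerivAt_tsum_pow_div_factorial (c := fun k => c (k + 1)) fun k => hc (k + 1)
  have hf : kummerPhi a b = fun z => ∑' k : ℕ, c k * (z ^ k / (k.factorial : ℂ)) := rfl
  have hdiff : Differentiable ℂ (kummerPhi a b) := fun z => (hd1 z).differentiableAt
  have hbound : ∀ z, ‖kummerPhi a b z‖ ≤ Real.exp (1 * ‖z‖) := fun z => by
    rw [one_mul]
    exact norm_tsum_pow_div_factorial_le hc z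
  have h0 : kummerPhi a b 0 = 1 := by
    rw [hf]
    simp only [tsum_pow_div_factorial_zero]
    simp [hcdef]
  have hderiv : deriv (kummerPhi a b) = fun z => ∑' k : ℕ, c (k + 1) * (z ^ k / (k.factorial : ℂ)) :=
    funext fun z => (hd1 z).deriv
  have h1 : deriv (kummerPhi a b) 0 = c 1 := by
    rw [hderiv]
    exact tsum_pow_div_factorial_zero fun k => c (k + 1)
  have h2 : deriv (deriv (kummerPhi a b)) 0 = c 2 := by
    rw [hderiv, (hd2 0).deriv]
    exact tsum_pow_div_factorial_zero fun k => c (k + 1 + 1)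
  have hterm : hypergeometricZetaTerm a b 2 = fun z : kummerZeros a b =>
      (analyticOrderNatAt (kummerPhi a b) z : ℂ) * (1 / (z : ℂ) ^ 2) := by
    funext z
    rw [hypergeometricZetaTerm, cpow_ofNat]
  refine ⟨?_, ?_⟩
  · rw [hterm]
    exact summable_norm_zeros_of_exponential_type hdiff h0 zero_le_one hbound
  · rw [hypergeometricZeta, hterm]
    refine (tsum_zeros_of_exponential_type hdiff h0 one_pos hbound).trans ?_
    rw [h1, h2]
    have hab : (a : ℂ) + b ≠ 0 := by exact_mod_cast (add_pos ha hb).ne'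
    have hab1 : 1 + (a : ℂ) + b ≠ 0 := by exact_mod_cast (by positivity : 1 + a + b ≠ 0)
    have hab2 : (a : ℂ) + b + 1 ≠ 0 := by rwa [add_comm, ← add_assoc]
    -- Here `c 1 = a / (a + b)` and `c 2 = a * (a + 1) / ((a + b) * (a + b + 1))`.
    simp only [hcdef, ascPochhammer_succ_eval, ascPochhammer_zero, Polynomial.eval_one, one_mul,
      Nat.cast_zero, Nat.cast_one, add_zero]
    field_simp
    ring
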